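/- Let $d\ge 0$ be an integer, let $r\in(0,1)$ and let $\nu\ge 1$ be an integer. The Conway--Maxwell-binomial distribution $\mathrm{CMB}_d(r,\nu)$ is the probability distribution on $\{0,1,\dots,d\}$ with $$f(k)=\frac{\binom{d}{k}^{\nu}r^k(1-r)^{d-k}}{\sum_{l=0}^d\binom{d}{l}^{\nu}r^l(1-r)^{d-l}},\qquad 0\le k\le d .$$ The Conway--Maxwell multivariate Bernoulli distribution $\mathrm{CMMB}_d(r,\nu)$ is the distribution of an exchangeable random vector $\boldsymbol I=(I_1,\dots,I_d)$ with values in $\{0,1\}^d$ such that $I_1+\dots+I_d\sim\mathrm{CMB}_d(r,\nu)$. A non-zero polynomial $p\in\mathbb C[z_1,\dots,z_n]$ is called stable if $p(z_1,\dots,z_n)\ne 0$ whenever $\operatorname{Im} z_j>0$ for all $j$, and real stable if moreover its coefficients are real. A random variable $W$ with values in $\{0,\dots,d\}$ is called strongly Rayleigh if its probability generating function $\sum_{k=0}^d \mathbb P(W=k)z^k$ is real stable, and a random vector $\boldsymbol I$ with values in $\{0,1\}^d$ is called strongly Rayleigh if its joint probability generating function $\sum_{\boldsymbol i\in\{0,1\}^d}\mathbb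 P(\boldsymbol I=\boldsymbol i)\,z_1^{i_1}\cdots z_d^{i_d}$ is real stable. **Theorem.** Every random variable $W\sim\mathrm{CMB}_d(r,\nu)$ is strongly Rayleigh, and all complex zeros of its probability generating function are real. Every random vector $\boldsymbol I\sim\mathrm{CMMB}_d(r,\nu)$ is strongly Rayleigh. -/

import Mathlib

open MeasureTheory ProbabilityTheory

/-- A complex polynomial in the variables `z_j`, `j : σ`, is stable if it is non-zero and does not
vanish at any point all of whose coordinates have positive imaginary part. -/
def MvIsStable {σ : Type*} (p : MvPolynomial σ ℂ) : Prop :=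
  p ≠ 0 ∧ ∀ z : σ → ℂ, (∀ j, 0 < (z j).im) → MvPolynomial.eval z p ≠ 0

/-- A polynomial with real coefficients is real stable if it is stable as a complex polynomial. -/
def MvIsRealStable {σ : Type*} (p : MvPolynomial σ ℝ) : Prop :=
  MvIsStable (MvPolynomial.map (algebraMap ℝ ℂ) p)

/-- Stability of a complex polynomial in one variable. -/
def IsStable (p : Polynomial ℂ) : Prop :=
  p ≠ 0 ∧ ∀ z : ℂ, 0 < z.im → Polynomial.eval z p ≠ 0

/-- Real stability of a real polynomial in one variable. -/
def IsRealStable (p : Polynomial ℝ) : Prop :=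
  IsStable (p.map (algebraMap ℝ ℂ))

/-- The probability generating function `∑_{k=0}^d P(W = k) z^k` of a random variable `W` with
values in `{0, …, d}`. -/
noncomputable def pgf {Ω : Type*} [MeasurableSpace Ω] (d : ℕ) (W : Ω → ℕ) (P : Measure Ω) :
    Polynomial ℝ :=
  ∑ k ∈ Finset.range (d + 1), Polynomial.C (P.real {ω | W ω = k}) * Polynomial.X ^ k

/-- The joint probability generating function `∑_{i ∈ {0,1}^d} P(I = i) z₁^{i₁} ⋯ z_d^{i_d}` of a
`d`-dimensional Bernoulli vector `I`. -/
noncomputable def jointPgf {Ω : Type*} [MeasurableSpace Ω] {d : ℕ} (I : Ω → Fin d → Fin 2)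
    (P : Measure Ω) : MvPolynomial (Fin d) ℝ :=
  ∑ i : Fin d → Fin 2,
    MvPolynomial.C (P.real {ω | I ω = i}) * ∏ j, MvPolynomial.X j ^ (i j : ℕ)

/-- A random variable with values in `{0, …, d}` is strongly Rayleigh if its probability generating
function is real stable. -/
def IsStronglyRayleighVar {Ω : Type*} [MeasurableSpace Ω] (d : ℕ) (W : Ω → ℕ)
    (P : Measure Ω) : Prop :=
  IsRealStable (pgf d W P)

/-- A Bernoulli vector is strongly Rayleigh if its joint probability generating function is real
stable. -/
def IsStronglyRayleighVec {Ω : Type*} [MeasurableSpace Ω] {d : ℕ} (I : Ω → Fin d → Fin 2)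
    (P : Measure Ω) : Prop :=
  MvIsRealStable (jointPgf I P)

/-- The unnormalized weights `binom(d,k)^ν r^k (1-r)^(d-k)`, for real `ν` and `0 ≤ k ≤ d`. -/
noncomputable def cmbWeight (d : ℕ) (r ν : ℝ) (k : ℕ) : ℝ :=
  (d.choose k : ℝ) ^ ν * r ^ k * (1 - r) ^ (d - k)

/-- The probability mass function of the Conway–Maxwell-binomial distribution, `0 ≤ k ≤ d`. -/
noncomputable def cmbPmf (d : ℕ) (r ν : ℝ) (k : ℕ) : ℝ :=
  cmbWeight d r ν k / ∑ l ∈ Finset.range (d + 1), cmbWeight d r ν l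

/-- `W ∼ CMB_d(r, ν)`: the random variable `W` takes values in `{0, …, d}` (almost surely) and has
the Conway–Maxwell-binomial probability mass function. -/
structure IsCMB {Ω : Type*} [MeasurableSpace Ω] (d : ℕ) (r ν : ℝ) (W : Ω → ℕ)
    (P : Measure Ω) : Prop where
  aemeasurable : AEMeasurable W P
  ae_le : ∀ᵐ ω ∂P, W ω ≤ d
  pmf_eq : ∀ k ≤ d, P.real {ω | W ω = k} = cmbPmf d r ν k

/-- A Bernoulli vector is exchangeable if permuting its coordinates does not change its law. -/
def IsExchangeable {Ω : Type*} [MeasurableSpace Ω] {d : ℕ} (I : Ω → Fin d → Fin 2)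
    (P : Measure Ω) : Prop :=
  ∀ σ : Equiv.Perm (Fin d), IdentDistrib (fun ω j => I ω (σ j)) I P P

/-- `I ∼ CMMB_d(r, ν)`: the Bernoulli vector `I` is exchangeable and the sum of its coordinates has
the distribution `CMB_d(r, ν)`. -/
structure IsCMMB {Ω : Type*} [MeasurableSpace Ω] {d : ℕ} (r ν : ℝ) (I : Ω → Fin d → Fin 2)
    (P : Measure Ω) : Prop where
  exchangeable : IsExchangeable I P
  sum_isCMB : IsCMB d r ν (fun ω => ∑ j, (I ω j : ℕ)) P

theorem cmbWeight_pos {d : ℕ} {r : ℝ} (ν : ℝ) (hr0 : 0 < r) (hr1 : r < 1) {k : ℕ} (hk : k ≤ d) :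
    0 < cmbWeight d r ν k := by
  have h1 : (0 : ℝ) < d.choose k := by exact_mod_cast Nat.choose_pos hk
  have h2 : 0 < 1 - r := by linarith
  unfold cmbWeight
  positivity

theorem cmbSum_pos {d : ℕ} {r : ℝ} (ν : ℝ) (hr0 : 0 < r) (hr1 : r < 1) :
    0 < ∑ l ∈ Finset.range (d + 1), cmbWeight d r ν l :=
  Finset.sum_pos (fun k hk => cmbWeight_pos ν hr0 hr1 (by simpa [Nat.lt_succ_iff] using hk))
    (by simp)

theorem cmbPmf_sum {d : ℕ} {r : ℝ} (ν : ℝ) (hr0 : 0 < r) (hr1 : r < 1) :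
    ∑ k ∈ Finset.range (d + 1), cmbPmf d r ν k = 1 := by
  unfold cmbPmf
  rw [← Finset.sum_div]
  exact div_self (cmbSum_pos ν hr0 hr1).ne'

/-- The distribution `CMMB_d(r, ν)` exists for all `d`, all `r ∈ (0,1)` and all real `ν`. -/
theorem exists_isCMMB (d : ℕ) (r ν : ℝ) (hr0 : 0 < r) (hr1 : r < 1) :
    ∃ P : Measure (Fin d → Fin 2), IsProbabilityMeasure P ∧
      IsCMMB r ν (fun i : Fin d → Fin 2 => i) P := by
  classical
  let s : (Fin d → Fin 2) → ℕ := fun i => ∑ j, (i j : ℕ)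
  have hs : ∀ i, s i ≤ d := fun i => by
    calc s i ≤ ∑ j : Fin d, 1 := Finset.sum_le_sum fun j _ => by omega
      _ = d := by simp
  let N : ℕ → ℕ := fun k => (Finset.univ.filter fun i => s i = k).card
  have hN : ∀ k ≤ d, N k ≠ 0 := fun k hk => by
    apply Finset.card_ne_zero_of_mem (a := fun j : Fin d => if (j : ℕ) < k then 1 else 0)
    simp only [Finset.mem_filter, Finset.mem_univ, true_and, s]
    have : ∀ j : Fin d, ((if (j : ℕ) < k then (1 : Fin 2) else 0 : Fin 2) : ℕ)
        = if (j : ℕ) < k then 1 else 0 := fun j => by split_ifs <;> rfl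
    simp only [this]
    rw [Fin.sum_univ_eq_sum_range (fun j => if j < k then 1 else 0) d]
    rw [← Finset.sum_filter, Finset.sum_const]
    have : (Finset.range d).filter (· < k) = Finset.range k := by ext; simp; omega
    simp [this]
  let f : (Fin d → Fin 2) → ℝ := fun i => cmbPmf d r ν (s i) / N (s i)
  have hf0 : ∀ i, 0 ≤ f i := fun i => div_nonneg
    (div_nonneg (cmbWeight_pos ν hr0 hr1 (hs i)).le (cmbSum_pos ν hr0 hr1).le) (Nat.cast_nonneg _)
  have hfib : ∀ k ≤ d, ∑ i with s i = k, f i = cmbPmf d r ν k := fun k hk => by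
    rw [Finset.sum_congr rfl (g := fun _ => cmbPmf d r ν k / N k)
      (fun i hi => by simp only [Finset.mem_filter] at hi; simp only [f, hi.2])]
    rw [Finset.sum_const, nsmul_eq_mul]
    exact mul_div_cancel₀ _ (by exact_mod_cast hN k hk)
  have hsum : ∑ i, f i = 1 := by
    rw [← Finset.sum_fiberwise_of_maps_to (s := Finset.univ) (t := Finset.range (d + 1)) (g := s)
      (fun i _ => by simpa [Nat.lt_succ_iff] using hs i)]
    rw [← cmbPmf_sum (d := d) ν hr0 hr1]
    exact Finset.sum_congr rfl fun k hk => hfib k (by simpa [Nat.lt_succ_iff] using hk)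
  let p : PMF (Fin d → Fin 2) := PMF.ofFintype (fun i => ENNReal.ofReal (f i)) (by
    rw [← ENNReal.ofReal_sum_of_nonneg fun i _ => hf0 i, hsum, ENNReal.ofReal_one])
  have hp : ∀ A : Set (Fin d → Fin 2), p.toMeasure A = ∑ i with i ∈ A, ENNReal.ofReal (f i) :=
    fun A => by
      rw [PMF.toMeasure_apply_fintype _ _]
      simp [Set.indicator_apply, Finset.sum_filter, p, PMF.ofFintype_apply]
  refine ⟨p.toMeasure, inferInstance, ⟨fun σ => ⟨(measurable_of_finite _).aemeasurable,
    (measurable_of_finite _).aemeasurable, ?_⟩, (measurable_of_finite _).aemeasurable,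
    Filter.Eventually.of_forall hs, fun k hk => ?_⟩⟩
  · ext A hA
    rw [Measure.map_apply (measurable_of_finite _) hA, Measure.map_apply (measurable_of_finite _) hA,
      hp, hp]
    refine Finset.sum_bij (fun i _ j => i (σ j)) (fun i hi => by simpa using hi)
      (fun i _ i' _ h => by
        funext j
        simpa using congrFun h (σ.symm j))
      (fun i hi => ⟨fun j => i (σ.symm j), by simpa using hi, by simp⟩) (fun i hi => ?_)
    have : s (fun j => i (σ j)) = s i := Equiv.sum_comp σ (fun j => (i j : ℕ))
    simp only [f, this]
  · rw [measureReal_def, hp, ← ENNReal.ofReal_sum_of_nonneg fun i _ => hf0 i,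
      ENNReal.toReal_ofReal (Finset.sum_nonneg fun i _ => hf0 i), ← hfib k hk]
    exact Finset.sum_congr (by ext; simp [s]) fun _ _ => rfl

/-! By exchangeability, the mass of the event that the sum is k spreads evenly over the binom(d,k)
supports of size k. So up to a constant the joint generating polynomial is F_n = ∑ binom(d,k)^n r^k
(1-r)^(d-k) e_k(z) with n = ν - 1, and the CMB generating polynomial is its diagonal.

F_n is stable by induction on n. F_0 is ∏ (r z_j + 1 - r). On the diagonal z_j = w, F_n becomes a
real-rooted ∑ h_k w^k whose coefficients have gained one binomial factor; `sum_mul_prod_ne_zero`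
then gives stability of ∑ h_k e_k(z) = F_{n+1}.

That lemma applies the Hermite–Poulain theorem (`eval_aeval_derivative_ne_zero`) twice. With D =
d/dX and H = ∑ h_k X^k, the polynomial G = H(D) X^d is real-rooted, and G(D) ∏ (z_j + X) at X = 0
equals d! ∑ h_k e_k(z). -/

/-! ### Hermite–Poulain: differential operators and zero-free half-planes -/

open Polynomial in
/-- If `p` has no zero with imaginary part in the upper set `U`, then neither has `p' - a p`, for
real `a ≠ 0`. -/
theorem eval_derivative_sub_smul_ne_zero {U : Set ℝ} (hU : IsUpperSet U) {p : ℂ[X]}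
    (hp : ∀ z : ℂ, z.im ∈ U → p.eval z ≠ 0) {a : ℂ} (ha : a.im = 0) (ha0 : a ≠ 0) (z : ℂ)
    (hz : z.im ∈ U) : (derivative p - C a * p).eval z ≠ 0 := by
  intro h
  have hpz := hp z hz
  have hp0 : p ≠ 0 := by rintro rfl; simp at hpz
  have h1 : (derivative p).eval z / p.eval z = a := by
    rw [div_eq_iff hpz]
    simpa [sub_eq_zero] using h
  -- p'/p is the sum of 1/(z - w) over the roots w, all strictly below z, so every term has negative
  -- imaginary part and a non-empty sum cannot be the real number a.
  rw [(IsAlgClosed.splits p).eval_derivative_div_eval_of_ne_zero hpz] at h1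
  have hlt : ∀ w ∈ p.roots, (1 / (z - w)).im < 0 := by
    intro w hw
    have hw' : w.im ∉ U := fun hw' => hp w hw' ((mem_roots hp0).1 hw)
    have him : w.im < z.im := lt_of_not_ge fun hle => hw' (hU hle hz)
    have hne : z - w ≠ 0 := fun h0 => by
      rw [sub_eq_zero] at h0
      exact him.ne (by rw [h0])
    rw [one_div, Complex.inv_im]
    refine div_neg_of_neg_of_pos ?_ (Complex.normSq_pos.2 hne)
    rw [Complex.sub_im]
    linarith
  have him : ((p.roots.map fun w => 1 / (z - w)).map Complex.imAddGroupHom).sum = 0 := by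
    rw [← map_multiset_sum, h1]
    exact ha
  rcases eq_or_ne p.roots 0 with h0 | h0
  · rw [h0] at h1
    exact ha0 (by simpa using h1.symm)
  · have := Multiset.sum_lt_sum_of_nonempty h0 hlt
    rw [Multiset.map_map] at him
    simp only [Multiset.map_const', Multiset.sum_replicate, smul_zero] at this
    exact this.ne him

open Polynomial in
/-- If `G` has only real, non-zero zeros, then the differential operator `G(d/dz)` preserves the
absence of zeros with imaginary part in an upper set. -/
theorem eval_aeval_derivative_ne_zero {U : Set ℝ} (hU : IsUpperSet U) {G p : ℂ[X]} (hG : G ≠ 0)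
    (hG0 : G.eval 0 ≠ 0) (hGr : ∀ a, G.eval a = 0 → a.im = 0)
    (hp : ∀ z : ℂ, z.im ∈ U → p.eval z ≠ 0) (z : ℂ) (hz : z.im ∈ U) :
    (aeval (derivative : ℂ[X] →ₗ[ℂ] ℂ[X]) G p).eval z ≠ 0 := by
  -- Each linear factor X - a of G acts as p ↦ p' - a p.
  have key : ∀ s : Multiset ℂ, (∀ a ∈ s, a.im = 0 ∧ a ≠ 0) → ∀ z : ℂ, z.im ∈ U →
      (aeval (derivative : ℂ[X] →ₗ[ℂ] ℂ[X]) (s.map fun a => X - C a).prod p).eval z ≠ 0 := by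
    intro s
    induction s using Multiset.induction_on with
    | empty => intro _ z hz; simpa using hp z hz
    | cons a s ih =>
      intro hs z hz
      have ha := hs a (Multiset.mem_cons_self a s)
      have := eval_derivative_sub_smul_ne_zero hU
        (ih fun b hb => hs b (Multiset.mem_cons_of_mem hb)) ha.1 ha.2 z hz
      rw [Multiset.map_cons, Multiset.prod_cons, map_mul, Module.End.mul_apply, map_sub, aeval_X,
        aeval_C, LinearMap.sub_apply, Module.algebraMap_end_apply, smul_eq_C_mul]
      exact this
  rw [(IsAlgClosed.splits G).eq_prod_roots, map_mul, aeval_C, Module.End.mul_apply,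
    Module.algebraMap_end_apply, eval_smul, smul_eq_mul]
  refine mul_ne_zero (leadingCoeff_ne_zero.2 hG) (key _ (fun a ha => ?_) z hz)
  have hroot : G.eval a = 0 := (mem_roots hG).1 ha
  exact ⟨hGr a hroot, fun h => hG0 (h ▸ hroot)⟩

open Polynomial in
/-- A real polynomial without zeros in the open upper half-plane has only real zeros. -/
theorem im_eq_zero_of_aeval_eq_zero {p : ℝ[X]} (hp : ∀ z : ℂ, 0 < z.im → aeval z p ≠ 0) {z : ℂ}
    (hz : aeval z p = 0) : z.im = 0 := by
  rcases lt_trichotomy z.im 0 with h | h | h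
  · refine absurd ?_ (hp (starRingEnd ℂ z) (by simpa using h))
    rw [aeval_conj, hz, map_zero]
  · exact h
  · exact absurd hz (hp z h)

/-! ### From univariate to symmetric multi-affine stability -/

open Polynomial in
/-- If `∑ h_k z^k` is stable, then so is `∑ h_k e_k(z_1, …, z_d)`. -/
theorem sum_mul_prod_ne_zero {d : ℕ} {h : ℕ → ℝ} (h0 : h 0 ≠ 0) (hd : h d ≠ 0)
    (hh : ∀ z : ℂ, 0 < z.im → ∑ k ∈ Finset.range (d + 1), (h k : ℂ) * z ^ k ≠ 0)
    (z : Fin d → ℂ) (hz : ∀ j, 0 < (z j).im) :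
    ∑ s : Finset (Fin d), (h s.card : ℂ) * ∏ j ∈ s, z j ≠ 0 := by
  let H : ℝ[X] := ∑ k ∈ Finset.range (d + 1), C (h k) * X ^ k
  let G : ℝ[X] := ∑ k ∈ Finset.range (d + 1), C (h k * d.descFactorial k) * X ^ (d - k)
  have hHe : ∀ w : ℂ, aeval w H = ∑ k ∈ Finset.range (d + 1), (h k : ℂ) * w ^ k := by simp [H]
  have hHr : ∀ w : ℂ, aeval w H = 0 → w.im = 0 := fun w =>
    im_eq_zero_of_aeval_eq_zero fun w hw => by rw [hHe]; exact hh w hw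
  have hH0 : (H.map (algebraMap ℝ ℂ)).eval 0 ≠ 0 := by
    rw [eval_map_algebraMap, hHe, Finset.sum_range_succ']
    simpa using h0
  have hG : aeval (derivative : ℂ[X] →ₗ[ℂ] ℂ[X]) (H.map (algebraMap ℝ ℂ)) (X ^ d)
      = G.map (algebraMap ℝ ℂ) := by
    simp only [H, G, Polynomial.map_sum, map_sum, Polynomial.map_mul, map_mul, Polynomial.map_pow,
      map_pow, map_X, map_C, aeval_X, aeval_C, LinearMap.sum_apply]
    refine Finset.sum_congr rfl fun k _ => ?_
    rw [Module.End.mul_apply, Module.algebraMap_end_apply, Module.End.pow_apply,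
      iterate_derivative_X_pow_eq_C_mul, smul_eq_C_mul]
    simp [mul_assoc]
  have hGr : ∀ w : ℂ, (G.map (algebraMap ℝ ℂ)).eval w = 0 → w.im = 0 := fun w hw => by
    rw [eval_map_algebraMap] at hw
    refine im_eq_zero_of_aeval_eq_zero (fun w hw => ?_) hw
    rw [← eval_map_algebraMap, ← hG]
    refine eval_aeval_derivative_ne_zero (isUpperSet_Ioi (0 : ℝ)) (fun h => by simp [h] at hH0) hH0
      (fun a ha => hHr a (by rwa [eval_map_algebraMap] at ha)) (fun w hw => ?_) w hw
    have hw0 : w ≠ 0 := by rintro rfl; simp at hw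
    simp [hw0]
  have hG0 : (G.map (algebraMap ℝ ℂ)).eval 0 ≠ 0 := by
    have : aeval (0 : ℂ) G = (h d * d.descFactorial d : ℝ) := by
      simp only [G, map_sum, map_mul, aeval_C, map_pow, aeval_X]
      rw [Finset.sum_range_succ, Finset.sum_eq_zero fun k hk => ?_]
      · simp
      · rw [zero_pow (Nat.sub_ne_zero_of_lt (Finset.mem_range.1 hk)), mul_zero]
    rw [eval_map_algebraMap, this, Complex.ofReal_ne_zero, Nat.descFactorial_self]
    exact mul_ne_zero hd (by exact_mod_cast d.factorial_ne_zero)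
  -- The closed half-plane is needed to evaluate at 0; the zeros -z_j lie strictly below the real
  -- axis.
  have key := eval_aeval_derivative_ne_zero (isUpperSet_Ici (0 : ℝ))
    (p := ∏ j, (C (z j) + X)) (fun h => by simp [h] at hG0) hG0 hGr (fun w hw => by
      rw [eval_prod]
      refine Finset.prod_ne_zero_iff.2 fun j _ h => ?_
      have hw' : 0 ≤ w.im := hw
      have := congrArg Complex.im h
      simp only [eval_add, eval_C, eval_X, Complex.add_im, Complex.zero_im] at this
      linarith [hz j]) 0 (by simp)
  have hterm : ∀ s : Finset (Fin d),
      (aeval (derivative : ℂ[X] →ₗ[ℂ] ℂ[X]) (G.map (algebraMap ℝ ℂ)) (X ^ (d - s.card))).eval 0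
        = (d.factorial : ℂ) * h s.card := by
    intro s
    have hs : s.card ≤ d := by simpa using Finset.card_le_univ s
    simp only [G, Polynomial.map_sum, map_sum, Polynomial.map_mul, map_mul, Polynomial.map_pow,
      map_pow, map_X, map_C, aeval_X, aeval_C, LinearMap.sum_apply, eval_finsetSum]
    rw [Finset.sum_eq_single_of_mem s.card (by simpa [Nat.lt_succ_iff] using hs)]
    · rw [← d.factorial_mul_descFactorial hs]
      simp [Module.End.mul_apply, Module.End.pow_apply, iterate_derivative_X_pow_eq_C_mul,
        Nat.descFactorial_self]
      ring
    · intro k hk hne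
      have hk' : k ≤ d := by simpa [Nat.lt_succ_iff] using hk
      -- For k < |s| the derivative order exceeds the degree; for k > |s| a positive power of X
      -- survives and vanishes at 0.
      rcases lt_or_gt_of_ne hne with hlt | hlt
      · have hdf : (d - s.card).descFactorial (d - k) = 0 :=
          Nat.descFactorial_eq_zero_iff_lt.2 (by omega)
        simp [Module.End.mul_apply, Module.End.pow_apply, iterate_derivative_X_pow_eq_C_mul, hdf]
      · have hpos : d - s.card - (d - k) ≠ 0 := by omega
        simp [Module.End.mul_apply, Module.End.pow_apply, iterate_derivative_X_pow_eq_C_mul, hpos]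
  have hexp : ∏ j, (C (z j) + X) = ∑ s : Finset (Fin d), (∏ j ∈ s, z j) • (X : ℂ[X]) ^ (d - s.card)
      := by
    rw [Finset.prod_add, Finset.powerset_univ]
    refine Finset.sum_congr rfl fun s _ => ?_
    rw [Finset.prod_const, Finset.card_sdiff_of_subset (Finset.subset_univ s), Finset.card_univ,
      Fintype.card_fin, smul_eq_C_mul, map_prod]
  rw [hexp, map_sum, eval_finsetSum] at key
  intro h
  refine key (Eq.trans ?_ ((congrArg ((d.factorial : ℂ) * ·) h).trans (mul_zero _)))
  rw [Finset.mul_sum]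
  refine Finset.sum_congr rfl fun s _ => ?_
  rw [map_smul, eval_smul, hterm, smul_eq_mul]
  ring

/-- Restriction to the diagonal is what supplies one more binomial factor. -/
theorem sum_card_mul_prod_const (d : ℕ) (f : ℕ → ℝ) (w : ℂ) :
    ∑ s : Finset (Fin d), (f s.card : ℂ) * ∏ _j ∈ s, w
      = ∑ k ∈ Finset.range (d + 1), ((d.choose k * f k : ℝ) : ℂ) * w ^ k := by
  simp only [Finset.prod_const]
  rw [← Finset.powerset_univ, Finset.sum_powerset_apply_card (fun k => (f k : ℂ) * w ^ k),
    Finset.card_univ, Fintype.card_fin]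
  refine Finset.sum_congr rfl fun k _ => ?_
  rw [nsmul_eq_mul]
  push_cast
  ring

/-- The polynomial `∑ binom(d,k)^n r^k (1-r)^(d-k) e_k(z_1, …, z_d)` is stable. -/
theorem sum_choose_pow_mul_prod_ne_zero (d n : ℕ) {r : ℝ} (hr0 : 0 < r) (hr1 : r < 1)
    (z : Fin d → ℂ) (hz : ∀ j, 0 < (z j).im) :
    ∑ s : Finset (Fin d), (((d.choose s.card : ℝ) ^ n * r ^ s.card * (1 - r) ^ (d - s.card) : ℝ) : ℂ)
      * ∏ j ∈ s, z j ≠ 0 := by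
  have hr1' : 0 < 1 - r := by linarith
  induction n generalizing z with
  | zero =>
    have : ∏ j, ((r : ℂ) * z j + (1 - r)) ≠ 0 := Finset.prod_ne_zero_iff.2 fun j _ h => by
      have := congrArg Complex.im h
      simp only [Complex.add_im, Complex.im_ofReal_mul, Complex.sub_im, Complex.one_im,
        Complex.ofReal_im, Complex.zero_im] at this
      nlinarith [hz j, mul_pos hr0 (hz j)]
    rw [Finset.prod_add, Finset.powerset_univ] at this
    convert this using 2 with s
    rw [Finset.prod_const, Finset.card_sdiff_of_subset (Finset.subset_univ s), Finset.card_univ,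
      Fintype.card_fin, Finset.prod_mul_distrib, Finset.prod_const]
    push_cast
    ring
  | succ n ih =>
    refine sum_mul_prod_ne_zero
      (h := fun k => (d.choose k : ℝ) ^ (n + 1) * r ^ k * (1 - r) ^ (d - k))
      (by simpa using pow_ne_zero d hr1'.ne') (by simpa using pow_ne_zero d hr0.ne')
      (fun w hw => ?_) z hz
    have := ih (fun _ => w) fun _ => hw
    rw [sum_card_mul_prod_const d fun k => (d.choose k : ℝ) ^ n * r ^ k * (1 - r) ^ (d - k)] at this
    simpa only [pow_succ', mul_assoc] using this

/-- The polynomial `∑ binom(d,k)^(n+1) r^k (1-r)^(d-k) z^k` is stable. -/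
theorem sum_choose_pow_mul_pow_ne_zero (d n : ℕ) {r : ℝ} (hr0 : 0 < r) (hr1 : r < 1)
    {w : ℂ} (hw : 0 < w.im) :
    ∑ k ∈ Finset.range (d + 1),
      (((d.choose k : ℝ) ^ (n + 1) * r ^ k * (1 - r) ^ (d - k) : ℝ) : ℂ) * w ^ k ≠ 0 := by
  have := sum_choose_pow_mul_prod_ne_zero d n hr0 hr1 (fun _ => w) fun _ => hw
  rw [sum_card_mul_prod_const d fun k => (d.choose k : ℝ) ^ n * r ^ k * (1 - r) ^ (d - k)] at this
  simpa only [pow_succ', mul_assoc] using this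


/-! ### Exchangeable Bernoulli vectors -/

/-- The Bernoulli vector with support `s`. -/
def bernoulliIndicator {d : ℕ} (s : Finset (Fin d)) : Fin d → Fin 2 := fun j => if j ∈ s then 1 else 0

theorem sum_bernoulliIndicator {d : ℕ} (s : Finset (Fin d)) :
    ∑ j, (bernoulliIndicator s j : ℕ) = s.card := by
  have : ∀ j, (bernoulliIndicator s j : ℕ) = if j ∈ s then 1 else 0 := fun j => by
    unfold bernoulliIndicator
    split_ifs <;> rfl
  simp [this]

theorem prod_pow_bernoulliIndicator {d : ℕ} {M : Type*} [CommMonoid M] (z : Fin d → M)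
    (s : Finset (Fin d)) : ∏ j, z j ^ (bernoulliIndicator s j : ℕ) = ∏ j ∈ s, z j := by
  have : ∀ j, z j ^ (bernoulliIndicator s j : ℕ) = if j ∈ s then z j else 1 := fun j => by
    unfold bernoulliIndicator
    split_ifs <;> simp
  simp [this, Finset.prod_ite_mem]

theorem bernoulliIndicator_bijective (d : ℕ) :
    Function.Bijective (bernoulliIndicator : Finset (Fin d) → Fin d → Fin 2) := by
  constructor
  · intro s t h
    ext j
    have := congrFun h j
    unfold bernoulliIndicator at this
    by_cases hs : j ∈ s <;> by_cases ht : j ∈ t <;> simp_all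
  · intro i
    refine ⟨Finset.univ.filter fun j => i j = 1, funext fun j => ?_⟩
    unfold bernoulliIndicator
    by_cases h : i j = 1
    · simp [h]
    · simp only [Finset.mem_filter, Finset.mem_univ, true_and, h, if_false]
      omega

section

variable {Ω : Type*} [MeasurableSpace Ω] {d : ℕ} {P : Measure Ω}

theorem IsExchangeable.measureReal_comp_perm {I : Ω → Fin d → Fin 2} (hI : IsExchangeable I P)
    (σ : Equiv.Perm (Fin d)) (i : Fin d → Fin 2) :
    P.real {ω | I ω = fun j => i (σ j)} = P.real {ω | I ω = i} := by
  have h := (hI σ).measure_mem_eq (s := {fun j => i (σ j)}) (measurableSet_singleton _)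
  have hset : (fun ω j => I ω (σ j)) ⁻¹' {fun j => i (σ j)} = {ω | I ω = i} := by
    ext ω
    simp only [Set.mem_preimage, Set.mem_singleton_iff, Set.mem_ofPred_eq]
    refine ⟨fun h => funext fun j => ?_, fun h => by rw [h]⟩
    simpa using congrFun h (σ.symm j)
  rw [hset] at h
  rw [measureReal_def, measureReal_def, h]
  rfl

theorem IsExchangeable.measureReal_eq_of_card_eq {I : Ω → Fin d → Fin 2}
    (hI : IsExchangeable I P) {s t : Finset (Fin d)} (h : s.card = t.card) :
    P.real {ω | I ω = bernoulliIndicator s} = P.real {ω | I ω = bernoulliIndicator t} := by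
  -- A bijection between `s` and `t` extends to a permutation of all coordinates.
  let σ : Equiv.Perm (Fin d) := (Finset.equivOfCardEq h).extendSubtype
  have hσ : (fun j => bernoulliIndicator t (σ j)) = bernoulliIndicator s := funext fun j => by
    unfold bernoulliIndicator
    by_cases hj : j ∈ s
    · rw [if_pos hj, if_pos (Equiv.extendSubtype_mem _ j hj)]
    · rw [if_neg hj, if_neg (Equiv.extendSubtype_not_mem _ j hj)]
  rw [← hσ, hI.measureReal_comp_perm]

theorem IsExchangeable.measureReal_sum_eq [IsProbabilityMeasure P] {I : Ω → Fin d → Fin 2}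
    (hI : IsExchangeable I P) (s : Finset (Fin d)) :
    P.real {ω | ∑ j, (I ω j : ℕ) = s.card}
      = d.choose s.card * P.real {ω | I ω = bernoulliIndicator s} := by
  have hm : AEMeasurable I P := (hI 1).aemeasurable_snd
  have hset : {ω | ∑ j, (I ω j : ℕ) = s.card}
      = ⋃ t ∈ Finset.powersetCard s.card Finset.univ, {ω | I ω = bernoulliIndicator t} := by
    ext ω
    obtain ⟨t, ht⟩ := (bernoulliIndicator_bijective d).2 (I ω)
    simp only [Set.mem_ofPred_eq, Set.mem_iUnion, ← ht, sum_bernoulliIndicator,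
      Finset.mem_powersetCard, Finset.subset_univ, true_and, exists_prop]
    exact ⟨fun h => ⟨t, h, rfl⟩, fun ⟨u, hu, h⟩ => (bernoulliIndicator_bijective d).1 h ▸ hu⟩
  rw [hset, measureReal_biUnion_finset₀]
  · rw [Finset.sum_congr rfl fun t ht =>
      hI.measureReal_eq_of_card_eq (Finset.mem_powersetCard.1 ht).2, Finset.sum_const,
      Finset.card_powersetCard, Finset.card_univ, Fintype.card_fin, nsmul_eq_mul]
  · intro t _ u _ htu
    refine Disjoint.aedisjoint (Set.disjoint_left.2 fun ω h h' => htu ?_)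
    exact (bernoulliIndicator_bijective d).1 (h.symm.trans h')
  · exact fun t _ => hm.nullMeasurable (measurableSet_singleton _)

/-! ### Generating polynomials of the CMB and CMMB laws -/

theorem cmbWeight_natCast (d : ℕ) (r : ℝ) (ν k : ℕ) :
    cmbWeight d r ν k = (d.choose k : ℝ) ^ ν * r ^ k * (1 - r) ^ (d - k) := by
  rw [cmbWeight, Real.rpow_natCast]

theorem IsCMB.aeval_pgf_ne_zero {r : ℝ} (hr0 : 0 < r) (hr1 : r < 1) {ν : ℕ} (hν : 1 ≤ ν)
    {W : Ω → ℕ} (hW : IsCMB d r ν W P) (z : ℂ) (hz : 0 < z.im) :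
    Polynomial.aeval z (pgf d W P) ≠ 0 := by
  obtain ⟨n, rfl⟩ := Nat.exists_eq_add_of_le' hν
  have hS := (cmbSum_pos (d := d) ((n + 1 : ℕ) : ℝ) hr0 hr1).ne'
  have := div_ne_zero (sum_choose_pow_mul_pow_ne_zero d n hr0 hr1 hz) (Complex.ofReal_ne_zero.2 hS)
  rw [Finset.sum_div] at this
  unfold pgf
  rw [map_sum]
  convert this using 2 with k hk
  rw [map_mul, Polynomial.aeval_C, map_pow, Polynomial.aeval_X,
    hW.pmf_eq k (by simpa [Nat.lt_succ_iff] using hk), cmbPmf, cmbWeight_natCast,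
    Complex.coe_algebraMap, Complex.ofReal_div]
  ring

/-- Sharing the mass among equally likely supports cancels one binomial factor, lowering the
exponent from n + 1 to n. -/
theorem IsCMMB.measureReal_eq [IsProbabilityMeasure P] {r : ℝ} {n : ℕ} {I : Ω → Fin d → Fin 2}
    (hI : IsCMMB r (n + 1 : ℕ) I P) (s : Finset (Fin d)) :
    P.real {ω | I ω = bernoulliIndicator s}
      = (d.choose s.card : ℝ) ^ n * r ^ s.card * (1 - r) ^ (d - s.card) /
        ∑ l ∈ Finset.range (d + 1), cmbWeight d r (n + 1 : ℕ) l := by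
  have hs : s.card ≤ d := by simpa using Finset.card_le_univ s
  have hc : (d.choose s.card : ℝ) ≠ 0 := by exact_mod_cast (Nat.choose_pos hs).ne'
  have h := hI.sum_isCMB.pmf_eq s.card hs
  rw [hI.exchangeable.measureReal_sum_eq, cmbPmf, cmbWeight_natCast, pow_succ'] at h
  apply mul_left_cancel₀ hc
  rw [h]
  ring

theorem IsCMMB.eval_jointPgf_ne_zero [IsProbabilityMeasure P] {r : ℝ} (hr0 : 0 < r) (hr1 : r < 1)
    {ν : ℕ} (hν : 1 ≤ ν) {I : Ω → Fin d → Fin 2} (hI : IsCMMB r ν I P) (z : Fin d → ℂ)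
    (hz : ∀ j, 0 < (z j).im) :
    MvPolynomial.eval z (MvPolynomial.map (algebraMap ℝ ℂ) (jointPgf I P)) ≠ 0 := by
  obtain ⟨n, rfl⟩ := Nat.exists_eq_add_of_le' hν
  have hS := (cmbSum_pos (d := d) ((n + 1 : ℕ) : ℝ) hr0 hr1).ne'
  have := div_ne_zero (sum_choose_pow_mul_prod_ne_zero d n hr0 hr1 z hz)
    (Complex.ofReal_ne_zero.2 hS)
  rw [Finset.sum_div] at this
  unfold jointPgf
  rw [← (bernoulliIndicator_bijective d).sum_comp, map_sum, map_sum]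
  convert this using 2 with s
  rw [map_mul, map_mul, MvPolynomial.map_C, MvPolynomial.eval_C, hI.measureReal_eq,
    Complex.coe_algebraMap, Complex.ofReal_div]
  simp only [map_prod, map_pow, MvPolynomial.map_X, MvPolynomial.eval_X]
  rw [prod_pow_bernoulliIndicator]
  ring

end

theorem mainTheorem1 (d : ℕ) (r : ℝ) (hr0 : 0 < r) (hr1 : r < 1) (ν : ℕ) (hν : 1 ≤ ν)
    {Ω : Type*} [MeasurableSpace Ω] (P : Measure Ω) [IsProbabilityMeasure P] :
    (∀ W : Ω → ℕ, IsCMB d r (ν : ℝ) W P →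
      IsStronglyRayleighVar d W P ∧
        ∀ z : ℂ, Polynomial.aeval z (pgf d W P) = 0 → z.im = 0) ∧
    (∀ I : Ω → Fin d → Fin 2, IsCMMB r (ν : ℝ) I P → IsStronglyRayleighVec I P) := by
  refine ⟨fun W hW => ⟨⟨fun h => ?_, fun z hz => ?_⟩, fun z hz => ?_⟩,
    fun I hI => ⟨fun h => ?_, hI.eval_jointPgf_ne_zero hr0 hr1 hν⟩⟩
  -- Non-vanishing at the single point i already excludes the zero polynomial.
  · refine hW.aeval_pgf_ne_zero hr0 hr1 hν Complex.I (by simp) ?_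
    rw [← Polynomial.eval_map_algebraMap, h, Polynomial.eval_zero]
  · rw [Polynomial.eval_map_algebraMap]
    exact hW.aeval_pgf_ne_zero hr0 hr1 hν z hz
  · exact im_eq_zero_of_aeval_eq_zero (hW.aeval_pgf_ne_zero hr0 hr1 hν) hz
  · refine hI.eval_jointPgf_ne_zero hr0 hr1 hν (fun _ => Complex.I) (by simp) ?_
    rw [h, map_zero]
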